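/- Consider time slots $t\in\{0,1,2,\dots\}$ and $M$ traffic flows. The vectors $A(t)=(A_1(t),\dots,A_M(t))\in\{0,1\}^M$ of packet arrivals are i.i.d. over slots with mean $\lambda=(\lambda_1,\dots,\lambda_M)$ (so $\lambda\in[0,1]^M$). Let $\mathcal A$ be a finite set of actions; each $\alpha\in\mathcal A$ has a frame size $T(\alpha)$, a positive integer, and a clearance vector $(\mu_1(\alpha),\dots,\mu_M(\alpha))$ of non-negative integers. Frame $0$ starts at slot $t[0]=0$; at the start $t[r]$ of frame $r$ a controller chooses an action $\alpha[r]\in\mathcal A$, and $t[r+1]=t[r]+T(\alpha[r])$. An algorithm is a rule for choosing the actions that may be randomized and may use the past, but is causal: $\alpha[r]$ is a measurable function of the arrivals on slots before $t[r]$ and of private randomness independent of the arrivals. Starting from a given finite vector $Q[0]$ of non-negative integers, the queue backlogs evolve by $$Q_m[r+1]=\max\bigl[Q_m[r]-\mu_m(\alpha[r]),0\bigr]+\sum_{\tau=t[r]}^{t[r]+T(\alpha[r])-1}A_m(\tau).$$ Queue $m$ is rate stable if $\lim_{R\to\infty}Q_m[R]/R=0$ with probability $1$. The code-constrained capacity region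 $\Lambda_{\mathcal A}$ is the set of rate vectors $\lambda\in[0,1]^M$ such that, for arrivals as above with mean $\lambda$, some algorithm makes all queues rate stable. Then a rate vector $\lambda\in[0,1]^M$ is in $\Lambda_{\mathcal A}$ if and only if there are numbers $p(\alpha)\ge 0$, $\alpha\in\mathcal A$, with $\sum_{\alpha\in\mathcal A}p(\alpha)=1$ and $$\lambda_m\le\frac{\sum_{\alpha\in\mathcal A}p(\alpha)\mu_m(\alpha)}{\sum_{\alpha\in\mathcal A}p(\alpha)T(\alpha)}\qquad\text{for all } m\in\{1,\dots,M\}.$$ The equivalence holds for every joint law of the arrival vector on $\{0,1\}^M$ with mean $\lambda$: for each such law, an algorithm that makes all queues rate stable exists if and only if such $p(\alpha)$ exist; in particular $\Lambda_{\mathcal A}$ does not depend on which such law is considered. -/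

import Mathlib

noncomputable section

namespace DynamicCoding

open MeasureTheory Filter Topology

/-- A frame-based coding system with `M` traffic flows and action set `Act`: every action has a
frame size (a positive number of slots) and a clearance vector (packets of each flow that it
delivers); `initialBacklog` is the queue backlog vector at time `0`. -/
structure CodingSystem (Act : Type*) (M : ℕ) where
  frameSize : Act → ℕ
  frameSize_pos : ∀ a, 1 ≤ frameSize a
  clearance : Act → Fin M → ℕ
  initialBacklog : Fin M → ℕ

/-- An arrival path: `x t m ∈ {0, 1}` is the number of packets of flow `m` arriving on slot `t`. -/
abbrev ArrivalPath (M : ℕ) : Type := ℕ → Fin M → Fin 2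

/-- Private randomness of the controller: a sequence of points of `[0, 1]`. -/
abbrev Seed : Type := ℕ → unitInterval

/-- The sample space: an arrival path together with the private randomness of the controller. -/
abbrev Sample (M : ℕ) : Type := ArrivalPath M × Seed

namespace CodingSystem

variable {Act : Type*} {M : ℕ}

/-- The slot `t[r]` that starts frame `r`, when action `a i` is used on frame `i`. -/
def frameStart (S : CodingSystem Act M) (a : ℕ → Act) (r : ℕ) : ℕ :=
  ∑ i ∈ Finset.range r, S.frameSize (a i)

/-- The number of packets of flow `m` that arrive during frame `r`. -/
def frameArrivals (S : CodingSystem Act M) (x : ArrivalPath M) (a : ℕ → Act) (m : Fin M)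
    (r : ℕ) : ℕ :=
  ∑ τ ∈ Finset.Ico (S.frameStart a r) (S.frameStart a r + S.frameSize (a r)), (x τ m : ℕ)

/-- The backlog `Q_m[r]` of queue `m` at the start of frame `r`:
`Q_m[r+1] = max (Q_m[r] - μ_m(a[r])) 0 + arrivals_m[r]`
(the subtraction of natural numbers is the one truncated at `0`). -/
def backlog (S : CodingSystem Act M) (x : ArrivalPath M) (a : ℕ → Act) (m : Fin M) : ℕ → ℕ
  | 0 => S.initialBacklog m
  | r + 1 => (S.backlog x a m r - S.clearance (a r) m) + S.frameArrivals x a m r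

/-- A (possibly randomized) algorithm for selecting the action `α r` of every frame `r`: the choice
is measurable, and it is causal, that is, it depends on the arrivals only through those of the
slots before the start `t[r]` of the frame (apart from the private randomness). -/
structure IsAlgorithm (S : CodingSystem Act M) (α : ℕ → Sample M → Act) : Prop where
  measurable : ∀ (r : ℕ) (a : Act), MeasurableSet {ω : Sample M | α r ω = a}
  causal : ∀ (r : ℕ) (x x' : ArrivalPath M) (u : Seed),
    (∀ τ < S.frameStart (fun i => α i (x, u)) r, x τ = x' τ) → α r (x, u) = α r (x', u)

/-- The probability on the sample space: arrival vectors are i.i.d. over slots with law `ν`, and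
the private randomness consists of i.i.d. uniform variables, independent of the arrivals. -/
def sampleMeasure (ν : Measure (Fin M → Fin 2)) [IsProbabilityMeasure ν] : Measure (Sample M) :=
  (Measure.infinitePi (fun _ : ℕ => ν)).prod
    (Measure.infinitePi (fun _ : ℕ => (volume : Measure unitInterval)))

/-- Queue `m` is rate stable: `Q_m[R] / R → 0` as `R → ∞`, with probability `1`. -/
def RateStable (S : CodingSystem Act M) (ν : Measure (Fin M → Fin 2)) [IsProbabilityMeasure ν]
    (α : ℕ → Sample M → Act) (m : Fin M) : Prop :=
  ∀ᵐ ω ∂(sampleMeasure ν),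
    Tendsto (fun R : ℕ => (S.backlog ω.1 (fun r => α r ω) m R : ℝ) / (R : ℝ)) atTop (𝓝 0)

/-- When the arrival vectors are i.i.d. with law `ν`, some algorithm makes all queues
rate stable. -/
def Supportable (S : CodingSystem Act M) (ν : Measure (Fin M → Fin 2))
    [IsProbabilityMeasure ν] : Prop :=
  ∃ α : ℕ → Sample M → Act, S.IsAlgorithm α ∧ ∀ m, S.RateStable ν α m

/-- The arrival law `ν` has rate vector `lam`, i.e. the arrival vector has expectation `lam`. -/
def HasRate (ν : Measure (Fin M → Fin 2)) (lam : Fin M → ℝ) : Prop :=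
  ∀ m, ∫ y, ((y m : ℕ) : ℝ) ∂ν = lam m

/-- The code-constrained capacity region: the rate vectors (of `{0, 1}`-valued arrivals, hence in
`[0, 1]^M`) such that i.i.d. arrivals with these rates can be supported by some algorithm. -/
def capacityRegion (S : CodingSystem Act M) : Set (Fin M → ℝ) :=
  {lam | (∀ m, lam m ∈ Set.Icc (0 : ℝ) 1) ∧
    ∀ (ν : Measure (Fin M → Fin 2)) [IsProbabilityMeasure ν], HasRate ν lam → S.Supportable ν}

end CodingSystem

end DynamicCoding

end

namespace DynamicCoding

open MeasureTheory ProbabilityTheory Filter Topology Finset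

/-! Necessity is pathwise. On one path where the law of large numbers and rate stability both hold,
arrivals over `R` frames are at most the backlog plus the clearance offered. By compactness of the
simplex, the empirical action frequencies have a limit point `p`; dividing by `R` along that
subsequence kills the backlog and leaves the inequality (`exists_subseq_tendsto_average`).

Sufficiency needs only a fixed open-loop schedule with action frequencies `p`. Each queue then has
arrival rate at most its service rate, and even with equality its backlog is sublinear
(`tendsto_queue_div`). -/

/-- The strong law of large numbers for a function of the coordinates of an i.i.d. sequence
in a finite space. -/
theorem ae_tendsto_average_infinitePi {X : Type*} [Finite X] [MeasurableSpace X]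
    [MeasurableSingletonClass X] (ν : Measure X) [IsProbabilityMeasure ν] (f : X → ℝ) :
    ∀ᵐ x ∂(Measure.infinitePi fun _ : ℕ => ν),
      Tendsto (fun n : ℕ => (∑ i ∈ range n, f (x i)) / n) atTop (𝓝 (∫ y, f y ∂ν)) := by
  have hf : Measurable f := measurable_of_finite f
  have hmap : ∀ i : ℕ, (Measure.infinitePi fun _ : ℕ => ν).map (fun x => f (x i)) = ν.map f := by
    intro i
    conv_rhs => rw [← Measure.infinitePi_map_eval (fun _ : ℕ => ν) i]
    rw [Measure.map_map hf (measurable_pi_apply i)]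
    rfl
  have hfi : ∀ i : ℕ, AEMeasurable (fun x : ℕ → X => f (x i))
      (Measure.infinitePi fun _ : ℕ => ν) :=
    fun i => (hf.comp (measurable_pi_apply i)).aemeasurable
  have hint : Integrable (fun x : ℕ → X => f (x 0)) (Measure.infinitePi fun _ : ℕ => ν) :=
    (measurePreserving_eval_infinitePi (fun _ : ℕ => ν) 0).integrable_comp_of_integrable
      (Integrable.of_finite (f := f))
  have h := strong_law_ae_real (μ := Measure.infinitePi fun _ : ℕ => ν)
    (fun i x => f (x i)) hint
    (fun i j hij => (iIndepFun_infinitePi (P := fun _ : ℕ => ν) (X := fun _ => f)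
      (fun _ => hf)).indepFun hij)
    (fun i => ⟨hfi i, hfi 0, by rw [hmap, hmap]⟩)
  have hval : ∫ x, f (x 0) ∂(Measure.infinitePi fun _ : ℕ => ν) = ∫ y, f y ∂ν := by
    have := (measurePreserving_eval_infinitePi (fun _ : ℕ => ν) 0).map_eq
    conv_rhs => rw [← this]
    rw [integral_map (measurable_pi_apply 0).aemeasurable hf.aestronglyMeasurable]
  rwa [hval] at h

/-- A probability vector on a finite type is the vector of weights of a probability measure. -/
theorem exists_isProbabilityMeasure_integral_eq_sum {X : Type*} [Fintype X] [MeasurableSpace X]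
    [MeasurableSingletonClass X] {p : X → ℝ} (hp : ∀ a, 0 ≤ p a) (hp1 : ∑ a, p a = 1) :
    ∃ ν : Measure X, IsProbabilityMeasure ν ∧ ∀ f : X → ℝ, ∫ y, f y ∂ν = ∑ a, p a * f a := by
  have hsum : ∑ a, ENNReal.ofReal (p a) = 1 := by
    rw [← ENNReal.ofReal_sum_of_nonneg fun a _ => hp a, hp1, ENNReal.ofReal_one]
  refine ⟨(PMF.ofFintype (fun a => ENNReal.ofReal (p a)) hsum).toMeasure, inferInstance,
    fun f => ?_⟩
  rw [PMF.integral_eq_sum]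
  simp [ENNReal.toReal_ofReal (hp _)]

/-- Every probability vector on a finite type is the vector of asymptotic frequencies of some
sequence, in the sense that time averages of countably many functions converge to their means. -/
theorem exists_seq_tendsto_average {X ι : Type*} [Fintype X] [Countable ι] {p : X → ℝ}
    (hp : ∀ a, 0 ≤ p a) (hp1 : ∑ a, p a = 1) (f : ι → X → ℝ) :
    ∃ a : ℕ → X, ∀ i,
      Tendsto (fun n : ℕ => (∑ r ∈ range n, f i (a r)) / n) atTop (𝓝 (∑ y, p y * f i y)) := by
  let _ : MeasurableSpace X := ⊤
  obtain ⟨ν, _, hν⟩ := exists_isProbabilityMeasure_integral_eq_sum hp hp1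
  -- Almost every i.i.d. sequence with law `p` works for all indices at once; fix one.
  obtain ⟨a, ha⟩ := (ae_all_iff.2 fun i => ae_tendsto_average_infinitePi ν (f i)).exists
  exact ⟨a, fun i => hν (f i) ▸ ha i⟩

/-- A sequence that is `o(n)` is bounded by `ε n + K`. -/
theorem exists_abs_le_of_tendsto_div {e : ℕ → ℝ}
    (he : Tendsto (fun n : ℕ => e n / n) atTop (𝓝 0)) {ε : ℝ} (hε : 0 < ε) :
    ∃ K : ℝ, ∀ n : ℕ, |e n| ≤ ε * n + K := by
  obtain ⟨N, hN⟩ := (Metric.tendsto_atTop.1 he) ε hε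
  refine ⟨∑ i ∈ range (N + 1), |e i|, fun n => ?_⟩
  have hK : 0 ≤ ∑ i ∈ range (N + 1), |e i| := sum_nonneg fun _ _ => abs_nonneg _
  rcases lt_or_ge n (N + 1) with h | h
  · have := single_le_sum (f := fun i => |e i|) (fun _ _ => abs_nonneg _) (mem_range.2 h)
    have h0 : 0 ≤ ε * n := by positivity
    linarith
  · have h1 := hN n (by omega)
    have hn : (0 : ℝ) < n := by exact_mod_cast (show 0 < n by omega)
    rw [Real.dist_eq, sub_zero, abs_div, abs_of_pos hn, div_lt_iff₀ hn] at h1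
    linarith

/-- A queue with bounded offered service whose long-run arrival rate does not exceed its long-run
offered service rate has a sublinear backlog. -/
theorem tendsto_queue_div {q b c : ℕ → ℕ} (hq : ∀ r, q (r + 1) = (q r - b r) + c r) {β : ℕ}
    (hb : ∀ r, b r ≤ β) {bbar cbar : ℝ} (hle : cbar ≤ bbar)
    (hB : Tendsto (fun n : ℕ => (∑ r ∈ range n, (b r : ℝ)) / n) atTop (𝓝 bbar))
    (hC : Tendsto (fun n : ℕ => (∑ r ∈ range n, (c r : ℝ)) / n) atTop (𝓝 cbar)) :
    Tendsto (fun n : ℕ => (q n : ℝ) / n) atTop (𝓝 0) := by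
  set D : ℕ → ℝ := fun n => ∑ r ∈ range n, (c r : ℝ) - ∑ r ∈ range n, (b r : ℝ) with hD
  have hDs : ∀ n, D (n + 1) = D n + c n - b n := fun n => by
    simp only [hD, sum_range_succ]; ring
  -- Here `s` is the last time before `n` at which the offered service emptied the queue, or `0`.
  -- The term `β` pays for the service possibly wasted in that step.
  have key : ∀ n, ∃ s ≤ n, (q n : ℝ) ≤ q 0 + β + D n - D s := by
    intro n
    induction n with
    | zero => exact ⟨0, le_rfl, by simp⟩
    | succ n ih =>
      rcases le_total (b n) (q n) with h | h
      · obtain ⟨s, hs, hqs⟩ := ih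
        refine ⟨s, by omega, ?_⟩
        rw [hq, Nat.cast_add, Nat.cast_sub h, hDs]
        linarith
      · refine ⟨n, by omega, ?_⟩
        rw [hq, Nat.sub_eq_zero_of_le h, hDs]
        have : (b n : ℝ) ≤ β := by exact_mod_cast hb n
        have : (0 : ℝ) ≤ q 0 := by positivity
        push_cast
        linarith
  -- With its drift removed, `D` is `o(n)`; the drift itself is nonpositive, so it can only lower `D
  -- n - D s`.
  set e : ℕ → ℝ := fun n => D n + (bbar - cbar) * n with he
  have hlim : Tendsto (fun n : ℕ => e n / n) atTop (𝓝 0) := by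
    have h := (hC.sub hB).add_const (bbar - cbar)
    rw [show cbar - bbar + (bbar - cbar) = 0 by ring] at h
    refine h.congr' ?_
    filter_upwards [eventually_gt_atTop 0] with n hn
    have : (n : ℝ) ≠ 0 := by positivity
    simp only [he, hD]
    field_simp
  rw [Metric.tendsto_atTop]
  intro ε hε
  -- Errors at both `n` and `s` cost `ε / 2` together; the other half absorbs the constants.
  obtain ⟨K, hK⟩ := exists_abs_le_of_tendsto_div hlim (ε := ε / 4) (by positivity)
  have hbound : ∀ n : ℕ, (q n : ℝ) ≤ ε / 2 * n + (q 0 + β + 2 * K) := by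
    intro n
    obtain ⟨s, hs, hqs⟩ := key n
    have hs' : (s : ℝ) ≤ n := by exact_mod_cast hs
    have h1 := (abs_le.1 (hK n)).2
    have h2 := (abs_le.1 (hK s)).1
    simp only [he] at h1 h2
    nlinarith [mul_nonneg (sub_nonneg.2 hle) (sub_nonneg.2 hs'),
      mul_nonneg hε.le (sub_nonneg.2 hs')]
  obtain ⟨N, hN⟩ := exists_nat_gt ((q 0 + β + 2 * K) / (ε / 2))
  refine ⟨N + 1, fun n hn => ?_⟩
  have hn0 : (0 : ℝ) < n := by exact_mod_cast (show 0 < n by omega)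
  have hNn : (N : ℝ) ≤ n := by exact_mod_cast (show N ≤ n by omega)
  rw [div_lt_iff₀ (by positivity)] at hN
  rw [Real.dist_eq, sub_zero, abs_of_nonneg (by positivity), div_lt_iff₀ hn0]
  have := hbound n
  nlinarith

/-- Every vector of `[0, 1]^M` is the rate vector of some law of the arrival vector. -/
theorem exists_hasRate {M : ℕ} {lam : Fin M → ℝ} (hlam : ∀ m, lam m ∈ Set.Icc (0 : ℝ) 1) :
    ∃ ν : Measure (Fin M → Fin 2), IsProbabilityMeasure ν ∧ CodingSystem.HasRate ν lam := by
  have h : ∀ m, ∃ ν : Measure (Fin 2), IsProbabilityMeasure ν ∧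
      ∫ y, ((y : ℕ) : ℝ) ∂ν = lam m := by
    intro m
    obtain ⟨ν, h1, h2⟩ := exists_isProbabilityMeasure_integral_eq_sum
      (p := ![1 - lam m, lam m])
      (by
        intro a
        have := hlam m
        fin_cases a
        · simpa using this.2
        · simpa using this.1)
      (by simp)
    exact ⟨ν, h1, by rw [h2 fun y => ((y : ℕ) : ℝ)]; simp⟩
  choose ν h1 h2 using h
  refine ⟨Measure.pi ν, inferInstance, fun m => ?_⟩
  rw [integral_comp_eval (μ := ν) (f := fun y : Fin 2 => ((y : ℕ) : ℝ))
    (measurable_of_finite _).aestronglyMeasurable, h2]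

namespace CodingSystem

variable {Act : Type*} {M : ℕ} (S : CodingSystem Act M)

theorem frameStart_succ (a : ℕ → Act) (r : ℕ) :
    S.frameStart a (r + 1) = S.frameStart a r + S.frameSize (a r) :=
  sum_range_succ _ _

theorem le_frameStart (a : ℕ → Act) (r : ℕ) : r ≤ S.frameStart a r := by
  induction r with
  | zero => exact Nat.zero_le _
  | succ r ih => rw [frameStart_succ]; have := S.frameSize_pos (a r); omega

theorem tendsto_frameStart (a : ℕ → Act) : Tendsto (S.frameStart a) atTop atTop :=
  tendsto_atTop_mono (S.le_frameStart a) tendsto_id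

theorem sum_frameArrivals (x : ArrivalPath M) (a : ℕ → Act) (m : Fin M) (R : ℕ) :
    ∑ r ∈ range R, S.frameArrivals x a m r = ∑ τ ∈ range (S.frameStart a R), (x τ m : ℕ) := by
  induction R with
  | zero => simp [frameStart]
  | succ R ih =>
    rw [sum_range_succ, ih, frameStart_succ, frameArrivals,
      sum_range_add_sum_Ico _ (Nat.le_add_right _ _)]

/-- A frame removes at most its clearance, and the initial backlog only adds to the right side. -/
theorem sum_frameArrivals_le (x : ArrivalPath M) (a : ℕ → Act) (m : Fin M) (R : ℕ) :
    ∑ r ∈ range R, S.frameArrivals x a m r ≤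
      S.backlog x a m R + ∑ r ∈ range R, S.clearance (a r) m := by
  induction R with
  | zero => simp
  | succ R ih =>
    rw [sum_range_succ, sum_range_succ, backlog]
    omega

/-- If the arrivals per slot have a long-run average, and so do the frame sizes along a sequence of
frames, then the arrivals per frame average to the product. -/
theorem tendsto_average_frameArrivals {x : ArrivalPath M} {m : Fin M} {l : ℝ}
    (hx : Tendsto (fun n : ℕ => (∑ τ ∈ range n, ((x τ m : ℕ) : ℝ)) / n) atTop (𝓝 l))
    (a : ℕ → Act) {φ : ℕ → ℕ} (hφ : Tendsto φ atTop atTop) {T : ℝ}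
    (hT : Tendsto (fun n => (∑ r ∈ range (φ n), (S.frameSize (a r) : ℝ)) / φ n) atTop (𝓝 T)) :
    Tendsto (fun n => (∑ r ∈ range (φ n), (S.frameArrivals x a m r : ℝ)) / φ n) atTop
      (𝓝 (l * T)) := by
  -- Arrivals per frame are arrivals per slot times slots per frame.
  refine ((hx.comp ((S.tendsto_frameStart a).comp hφ)).mul hT).congr' ?_
  filter_upwards [hφ.eventually_gt_atTop 0] with n hn
  have h1 : (0 : ℝ) < S.frameStart a (φ n) := by
    exact_mod_cast hn.trans_le (S.le_frameStart a _)
  have h2 : (∑ r ∈ range (φ n), (S.frameSize (a r) : ℝ)) = S.frameStart a (φ n) := by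
    simp [frameStart]
  have h3 : (∑ r ∈ range (φ n), (S.frameArrivals x a m r : ℝ)) =
      ∑ τ ∈ range (S.frameStart a (φ n)), ((x τ m : ℕ) : ℝ) := by
    exact_mod_cast congrArg (Nat.cast (R := ℝ)) (S.sum_frameArrivals x a m (φ n))
  simp only [Function.comp_apply, h2, h3]
  field_simp

theorem ae_tendsto_average_arrivals {ν : Measure (Fin M → Fin 2)} [IsProbabilityMeasure ν]
    {lam : Fin M → ℝ} (hν : HasRate ν lam) (m : Fin M) :
    ∀ᵐ ω ∂(sampleMeasure ν),
      Tendsto (fun n : ℕ => (∑ τ ∈ range n, ((ω.1 τ m : ℕ) : ℝ)) / n) atTop (𝓝 (lam m)) := by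
  have h := ae_tendsto_average_infinitePi ν (fun y => ((y m : ℕ) : ℝ))
  rw [hν m] at h
  exact Measure.quasiMeasurePreserving_fst.ae h

instance isProbabilityMeasure_sampleMeasure (ν : Measure (Fin M → Fin 2))
    [IsProbabilityMeasure ν] : IsProbabilityMeasure (sampleMeasure ν) := by
  unfold sampleMeasure; infer_instance

variable [Fintype Act]

theorem sum_mul_frameSize_pos {p : Act → ℝ} (hp : ∀ a, 0 ≤ p a) (hp1 : ∑ a, p a = 1) :
    0 < ∑ a, p a * (S.frameSize a : ℝ) := by
  have : ∑ a, p a ≤ ∑ a, p a * (S.frameSize a : ℝ) :=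
    sum_le_sum fun a _ => le_mul_of_one_le_right (hp a) (by exact_mod_cast S.frameSize_pos a)
  linarith

/-- Time averages along a sequence in a finite type converge, along a subsequence, to the means
under some probability vector. -/
theorem exists_subseq_tendsto_average (a : ℕ → Act) :
    ∃ p : Act → ℝ, (∀ y, 0 ≤ p y) ∧ ∑ y, p y = 1 ∧ ∃ φ : ℕ → ℕ, Tendsto φ atTop atTop ∧
      ∀ f : Act → ℝ, Tendsto (fun n => (∑ r ∈ range (φ n), f (a r)) / φ n) atTop
        (𝓝 (∑ y, p y * f y)) := by
  classical
  -- Averaging over `n + 1` frames keeps every `P n` in the simplex, including `n = 0`.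
  set P : ℕ → Act → ℝ := fun n y =>
    (∑ r ∈ range (n + 1), if a r = y then (1 : ℝ) else 0) / (n + 1 : ℕ) with hP
  have hPf : ∀ n (f : Act → ℝ),
      ∑ y, P n y * f y = (∑ r ∈ range (n + 1), f (a r)) / (n + 1 : ℕ) := by
    intro n f
    simp only [hP, div_mul_eq_mul_div, sum_mul]
    rw [← sum_div, sum_comm]
    simp
  have hmem : ∀ n, P n ∈ stdSimplex ℝ Act := by
    refine fun n => ⟨fun y => ?_, ?_⟩
    · exact div_nonneg (sum_nonneg fun _ _ => by split_ifs <;> norm_num) (Nat.cast_nonneg _)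
    · have := hPf n fun _ => 1
      simp only [mul_one, sum_const, card_range, nsmul_eq_mul] at this
      rw [this, div_self (by positivity)]
  obtain ⟨p, hp, ψ, hψ, hlim⟩ := (isCompact_stdSimplex ℝ Act).tendsto_subseq hmem
  refine ⟨p, hp.1, hp.2, fun n => ψ n + 1,
    tendsto_atTop_mono (fun n => Nat.le_succ _) hψ.tendsto_atTop, fun f => ?_⟩
  have := tendsto_finsetSum univ fun y _ => ((tendsto_pi_nhds.1 hlim) y).mul_const (f y)
  refine this.congr fun n => ?_
  exact hPf (ψ n) f

theorem exists_weights_of_supportable {ν : Measure (Fin M → Fin 2)} [IsProbabilityMeasure ν]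
    {lam : Fin M → ℝ} (hν : HasRate ν lam) (h : S.Supportable ν) :
    ∃ p : Act → ℝ, (∀ a, 0 ≤ p a) ∧ ∑ a, p a = 1 ∧
      ∀ m, lam m ≤
        (∑ a, p a * (S.clearance a m : ℝ)) / (∑ a, p a * (S.frameSize a : ℝ)) := by
  obtain ⟨α, -, hst⟩ := h
  obtain ⟨ω, hω, hωst⟩ := ((ae_all_iff.2 fun m => ae_tendsto_average_arrivals hν m).and
    (ae_all_iff.2 hst)).exists
  obtain ⟨p, hp, hp1, φ, hφ, hlim⟩ := exists_subseq_tendsto_average fun r => α r ω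
  refine ⟨p, hp, hp1, fun m => ?_⟩
  rw [le_div_iff₀ (S.sum_mul_frameSize_pos hp hp1)]
  have h1 := S.tendsto_average_frameArrivals (hω m) (fun r => α r ω) hφ
    (hlim fun a => (S.frameSize a : ℝ))
  have h2 := ((hωst m).comp hφ).add (hlim fun a => (S.clearance a m : ℝ))
  rw [zero_add] at h2
  refine le_of_tendsto_of_tendsto' h1 h2 fun n => ?_
  rw [Function.comp_apply, ← add_div]
  gcongr
  exact_mod_cast S.sum_frameArrivals_le ω.1 (fun r => α r ω) m (φ n)

theorem supportable_of_weights {ν : Measure (Fin M → Fin 2)} [IsProbabilityMeasure ν]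
    {lam : Fin M → ℝ} (hν : HasRate ν lam) {p : Act → ℝ} (hp : ∀ a, 0 ≤ p a)
    (hp1 : ∑ a, p a = 1)
    (hle : ∀ m, lam m ≤
      (∑ a, p a * (S.clearance a m : ℝ)) / (∑ a, p a * (S.frameSize a : ℝ))) :
    S.Supportable ν := by
  -- One schedule must serve all averages: `none` indexes frame size, `some m` the clearance of flow
  -- `m`.
  obtain ⟨a, ha⟩ := exists_seq_tendsto_average hp hp1
    (fun (i : Option (Fin M)) y => i.elim (S.frameSize y : ℝ) fun m => (S.clearance y m : ℝ))
  refine ⟨fun r _ => a r, ⟨fun r b => MeasurableSet.const _, fun _ _ _ _ _ => rfl⟩, fun m => ?_⟩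
  filter_upwards [ae_tendsto_average_arrivals hν m] with ω hω
  have hC := S.tendsto_average_frameArrivals hω a tendsto_id (ha none)
  exact tendsto_queue_div (fun r => rfl)
    (fun r => single_le_sum (f := fun y => S.clearance y m) (fun _ _ => Nat.zero_le _)
      (mem_univ (a r)))
    ((le_div_iff₀ (S.sum_mul_frameSize_pos hp hp1)).1 (hle m)) (ha (some m)) hC

theorem supportable_iff {ν : Measure (Fin M → Fin 2)} [IsProbabilityMeasure ν]
    {lam : Fin M → ℝ} (hν : HasRate ν lam) :
    S.Supportable ν ↔ ∃ p : Act → ℝ, (∀ a, 0 ≤ p a) ∧ ∑ a, p a = 1 ∧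
      ∀ m, lam m ≤
        (∑ a, p a * (S.clearance a m : ℝ)) / (∑ a, p a * (S.frameSize a : ℝ)) :=
  ⟨S.exists_weights_of_supportable hν,
    fun ⟨_, hp, hp1, hle⟩ => S.supportable_of_weights hν hp hp1 hle⟩

end CodingSystem

end DynamicCoding

/-- A rate vector is in the code-constrained capacity region iff it is dominated by the service
rates of some probability distribution on the actions; moreover, for every joint law of the arrival
vector with these rates, this is also equivalent to the existence of a stabilizing algorithm. -/
theorem theorem2 {Act : Type*} [Fintype Act] {M : ℕ}
    (S : DynamicCoding.CodingSystem Act M) (lam : Fin M → ℝ)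
    (hlam : ∀ m, lam m ∈ Set.Icc (0 : ℝ) 1) :
    (lam ∈ S.capacityRegion ↔
      ∃ p : Act → ℝ, (∀ a, 0 ≤ p a) ∧ ∑ a, p a = 1 ∧
        ∀ m, lam m ≤
          (∑ a, p a * (S.clearance a m : ℝ)) / (∑ a, p a * (S.frameSize a : ℝ))) ∧
    (∀ (ν : MeasureTheory.Measure (Fin M → Fin 2)) [MeasureTheory.IsProbabilityMeasure ν],
      DynamicCoding.CodingSystem.HasRate ν lam →
        (S.Supportable ν ↔
          ∃ p : Act → ℝ, (∀ a, 0 ≤ p a) ∧ ∑ a, p a = 1 ∧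
            ∀ m, lam m ≤
              (∑ a, p a * (S.clearance a m : ℝ)) / (∑ a, p a * (S.frameSize a : ℝ)))) := by
  refine ⟨⟨fun h => ?_, fun h => ⟨hlam, fun ν _ hν => (S.supportable_iff hν).2 h⟩⟩,
    fun ν _ hν => S.supportable_iff hν⟩
  -- Membership quantifies over all laws with mean `lam`, so one must exist for it to have content.
  obtain ⟨ν, _, hν⟩ := DynamicCoding.exists_hasRate hlam
  exact (S.supportable_iff hν).1 (h.2 ν hν)
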